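/- For a field \(\mathbb{F}\) and an integer \(n\ge 2\), let \(\Gamma(\mathbb{F},n)\) be the commuting graph of \(M_n(\mathbb{F})\): its vertices are the nonscalar \(n\times n\) matrices over \(\mathbb{F}\), and two distinct vertices are adjacent if and only if they commute. Let \(p\) be a prime and let \(n\ge 2\) be an integer such that \(\Gamma(\mathbb{Q}_p,n)\) is connected and every field extension \(\mathbb{K}/\mathbb{Q}_p\) of degree \(n\) has an intermediate field \(\mathbb{Q}_p\subseteq\mathbb{E}\subseteq\mathbb{K}\) with \(1<[\mathbb{E}:\mathbb{Q}_p]<\sqrt{n}\). Then the diameter of \(\Gamma(\mathbb{Q}_p,n)\) is at most \(5\), that is, any two vertices are joined by a path of length at most \(5\). -/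

import Mathlib

/-- The commuting graph of `M_n(F)`: its vertices are the nonscalar `n × n` matrices over `F`,
and two distinct vertices are adjacent if and only if they commute. -/
def commutingGraph (F : Type*) [Field F] (n : ℕ) :
    SimpleGraph {A : Matrix (Fin n) (Fin n) F // ∀ c : F, A ≠ Matrix.scalar (Fin n) c} where
  Adj A B := A ≠ B ∧ Commute A.1 B.1
  symm := ⟨fun _ _ h => ⟨h.1.symm, h.2.symm⟩⟩
  loopless := ⟨fun _ h => h.1 rfl⟩

/-!
Any two nonscalar matrices `A` and `B` are joined by a path `A - X - U - W - Y - B`. The middle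
edge comes from `U * W = W * U = 0`: if `U` takes values in a subspace `R` and `W` in a subspace
`R'`, it suffices that `U` vanishes on `R'` and `W` on `R`. So it is enough that every `A` commutes
with some nonscalar `X` which has, for a fixed subspace `R` with `(dim R)² < n`, nonzero commuting
maps into `R` vanishing on any prescribed subspace `S` with `(dim S)² < n`
(`HasNarrowCommutants`, `exists_commute_hasNarrowCommutants`).

Two kinds of `X` have this property. If `dim (ker X) ≥ n / 2`, the commuting maps are of rank one
(`hasNarrowCommutants_of_le_two_mul_finrank_ker`); such an `X` exists when `F[A]` is not a field,
or is a field of degree less than `n`. If `F[A]` is a field of degree `n`, it has an intermediate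
field `E` with `1 < [E : F] < √n`, and any `X ∈ E` outside `F` works: `E`-linear maps of `E`-rank
one have `F`-rank `[E : F]`, and a subspace `S` with `(dim S)² < n` cannot span `Fⁿ` over `E`,
since `dim S < √n < n / [E : F]` (`hasNarrowCommutants_lsmul`).

The argument works over every field `F` when `n ≥ 3`. For `n = 2` the hypothesis on
intermediate fields fails, because `ℚ_p` has the quadratic extension `ℚ_p(√p)`.
-/

open Module

/-! ### Endomorphisms with many commuting maps of small rank -/

section Narrow

variable {F V : Type*} [Field F] [AddCommGroup V] [Module F V]

/-- Call a subspace of `V` small if the square of its dimension is less than `dim V`. The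
endomorphism `X` has narrow commutants if there is a fixed small subspace `R` such that every
small subspace `S` is killed by some nonzero `U` that commutes with `X` and takes values
in `R`. -/
def HasNarrowCommutants (X : End F V) : Prop :=
  ∃ R : Submodule F V, finrank F R ^ 2 < finrank F V ∧
    ∀ S : Submodule F V, finrank F S ^ 2 < finrank F V →
      ∃ U : End F V, U ≠ 0 ∧ Commute X U ∧ LinearMap.range U ≤ R ∧ S ≤ LinearMap.ker U

/-- Each of the two commutants is chosen to vanish on the target subspace of the other one. -/
theorem HasNarrowCommutants.exists_mul_eq_zero {X Y : End F V}
    (hX : HasNarrowCommutants X) (hY : HasNarrowCommutants Y) :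
    ∃ U W : End F V, U ≠ 0 ∧ W ≠ 0 ∧ Commute X U ∧ Commute Y W ∧ U * W = 0 ∧ W * U = 0 := by
  obtain ⟨R, hR, hX⟩ := hX
  obtain ⟨R', hR', hY⟩ := hY
  obtain ⟨U, hU, hXU, hUR, hUS⟩ := hX R' hR'
  obtain ⟨W, hW, hYW, hWR, hWS⟩ := hY R hR
  exact ⟨U, W, hU, hW, hXU, hYW,
    LinearMap.range_le_ker_iff.1 (hWR.trans hUS), LinearMap.range_le_ker_iff.1 (hUR.trans hWS)⟩

theorem ne_algebraMap_of_mul_eq_zero {R : Type*} [Ring R] [Algebra F R] {u w : R}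
    (hu : u ≠ 0) (hw : w ≠ 0) (h : u * w = 0) (c : F) : u ≠ algebraMap F R c := by
  rintro rfl
  rw [← Algebra.smul_def] at h
  have hc : c ≠ 0 := by
    rintro rfl
    simp at hu
  exact hw ((smul_eq_zero_iff_right hc).1 h)

theorem smulRight_ne_zero {E : Type*} [Field E] [Module E V] {f : V →ₗ[E] E} (hf : f ≠ 0)
    {v : V} (hv : v ≠ 0) : f.smulRight v ≠ 0 := by
  obtain ⟨y, hy⟩ := DFunLike.ne_iff.1 hf
  exact fun h => (smul_eq_zero.1 (show f y • v = 0 from LinearMap.congr_fun h y)).elim hy hv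

/-- If `ker X` has at least half the dimension of `V`, then `X` is annihilated on both sides by
the rank-one maps `y ↦ f y • v` with `v ∈ ker X` and `f` vanishing on `range X`, and there is
room to let `f` vanish on `S` as well. -/
theorem hasNarrowCommutants_of_le_two_mul_finrank_ker [FiniteDimensional F V]
    (hV : 3 ≤ finrank F V) {X : End F V}
    (hker : finrank F V ≤ 2 * finrank F (LinearMap.ker X)) : HasNarrowCommutants X := by
  have hpos : 0 < finrank F (LinearMap.ker X) := by omega
  obtain ⟨v, hv⟩ := (finrank_pos_iff_exists_ne_zero).1 hpos
  have hv0 : (v : V) ≠ 0 := by simpa using hv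
  refine ⟨Submodule.span F {(v : V)}, ?_, fun S hS => ?_⟩
  · rw [finrank_span_singleton hv0]
    omega
  -- otherwise `dim (ker X) ^ 2 < dim V ≤ 2 * dim (ker X)`, so `dim (ker X) ≤ 1` and `dim V ≤ 2`
  have hSX : finrank F S < finrank F (LinearMap.ker X) := by
    by_contra! h
    nlinarith
  have hlt : LinearMap.range X ⊔ S < ⊤ := by
    apply Submodule.lt_top_of_finrank_lt_finrank
    have h1 := Submodule.finrank_add_le_finrank_add_finrank (LinearMap.range X) S
    have h2 := LinearMap.finrank_range_add_finrank_ker X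
    omega
  obtain ⟨f, hf, hle⟩ := Submodule.exists_le_ker_of_lt_top _ hlt
  refine ⟨f.smulRight (v : V), ?_, ?_, ?_, ?_⟩
  · exact smulRight_ne_zero hf hv0
  · ext y
    have h1 : f (X y) = 0 := hle (Submodule.mem_sup_left ⟨y, rfl⟩)
    have h2 : X v = 0 := v.2
    simp [h1, h2]
  · rintro _ ⟨y, rfl⟩
    exact Submodule.mem_span_singleton.2 ⟨f y, rfl⟩
  · intro y hy
    have : f y = 0 := hle (Submodule.mem_sup_right hy)
    simp [this]

variable {E : Type*} [Field E] [Algebra F E] [Module E V] [IsScalarTower F E V]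

theorem finrank_span_le_finrank [FiniteDimensional F V] (S : Submodule F V) :
    finrank E (Submodule.span E (S : Set V)) ≤ finrank F S := by
  let b := Module.finBasis F S
  have hspan : Submodule.span E (S : Set V) = Submodule.span E (Set.range fun i => (b i : V)) := by
    refine le_antisymm (Submodule.span_le.2 fun x hx => ?_) (Submodule.span_mono ?_)
    · have := b.sum_repr ⟨x, hx⟩
      have h2 : x = ∑ i, b.repr ⟨x, hx⟩ i • (b i : V) := by
        conv_lhs => rw [show x = ((⟨x, hx⟩ : S) : V) from rfl, ← this]
        simp only [Submodule.coe_sum, Submodule.coe_smul]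
      rw [h2]
      refine Submodule.sum_mem _ fun i _ => ?_
      exact Submodule.smul_of_tower_mem _ _ (Submodule.subset_span ⟨i, rfl⟩)
    · rintro _ ⟨i, rfl⟩
      exact (b i).2
  rw [hspan]
  exact (finrank_range_le_card (R := E) fun i => (b i : V)).trans_eq (Fintype.card_fin _)

theorem finrank_restrictScalars_span_singleton {v : V} (hv : v ≠ 0) :
    finrank F ((Submodule.span E {v}).restrictScalars F) = finrank F E := by
  have h := finrank_mul_finrank F E (Submodule.span E {v})
  rw [finrank_span_singleton hv, mul_one] at h
  exact h.symm

/-- Multiplication by `x ∈ E` commutes with the `E`-linear maps of `E`-rank one; such a map has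
`F`-rank `[E : F]`, and it can be made to vanish on `S` as soon as `S` does not span `V`
over `E`. -/
theorem hasNarrowCommutants_lsmul [FiniteDimensional F V] [FiniteDimensional F E]
    (hE : finrank F E ^ 2 < finrank F V) (x : E) :
    HasNarrowCommutants (Algebra.lsmul F F V x) := by
  have : FiniteDimensional E V := FiniteDimensional.right F E V
  have htower := finrank_mul_finrank F E V
  have hpos : 0 < finrank F V := by omega
  obtain ⟨v, hv⟩ := finrank_pos_iff_exists_ne_zero.1 hpos
  refine ⟨(Submodule.span E {v}).restrictScalars F, ?_, fun S hS => ?_⟩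
  · rwa [finrank_restrictScalars_span_singleton hv]
  have hlt : Submodule.span E (S : Set V) < ⊤ := by
    apply Submodule.lt_top_of_finrank_lt_finrank
    refine (finrank_span_le_finrank S).trans_lt ?_
    by_contra! h
    have h1 : finrank F V ≤ finrank F E * finrank F S := htower ▸ Nat.mul_le_mul_left _ h
    -- `dim V ≤ e * s` is incompatible with `e ^ 2 < dim V` and `s ^ 2 < dim V`
    nlinarith [sq_nonneg ((finrank F E : ℤ) - finrank F S)]
  obtain ⟨f, hf, hle⟩ := Submodule.exists_le_ker_of_lt_top _ hlt
  refine ⟨(f.smulRight v).restrictScalars F, ?_, ?_, ?_, ?_⟩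
  · exact fun h => smulRight_ne_zero hf hv (LinearMap.restrictScalars_injective F h)
  · ext y
    simp
  · rintro _ ⟨y, rfl⟩
    exact Submodule.mem_span_singleton.2 ⟨f y, rfl⟩
  · intro y hy
    have : f y = 0 := hle (Submodule.subset_span hy)
    simp [this]

/-- An `E`-linear map of `E`-rank one has `F`-rank `[E : F]`, which is at most half of `dim V`
when `V` is not one-dimensional over `E`. -/
theorem exists_ne_zero_commute_lsmul [FiniteDimensional F V] [FiniteDimensional F E]
    (hE : finrank F E ≠ finrank F V) (hV : 0 < finrank F V) :
    ∃ X : End F V, X ≠ 0 ∧ finrank F V ≤ 2 * finrank F (LinearMap.ker X) ∧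
      ∀ x : E, Commute (Algebra.lsmul F F V x) X := by
  have : FiniteDimensional E V := FiniteDimensional.right F E V
  have htower := finrank_mul_finrank F E V
  obtain ⟨v, hv⟩ := finrank_pos_iff_exists_ne_zero.1 hV
  have : Nontrivial V := ⟨v, 0, hv⟩
  obtain ⟨f, hf⟩ := exists_ne (0 : Module.Dual E V)
  refine ⟨(f.smulRight v).restrictScalars F,
    fun h => smulRight_ne_zero hf hv (LinearMap.restrictScalars_injective F h), ?_, fun x => ?_⟩
  · have h2 : 2 ≤ finrank E V := by
      have : 0 < finrank E V := finrank_pos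
      by_contra! h
      have : finrank E V = 1 := by omega
      rw [this, mul_one] at htower
      exact hE htower
    have hrange : LinearMap.range ((f.smulRight v).restrictScalars F) ≤
        (Submodule.span E {v}).restrictScalars F := by
      rintro _ ⟨y, rfl⟩
      exact Submodule.mem_span_singleton.2 ⟨f y, rfl⟩
    have h1 := Submodule.finrank_mono hrange
    have h3 := LinearMap.finrank_range_add_finrank_ker ((f.smulRight v).restrictScalars F)
    rw [finrank_restrictScalars_span_singleton hv] at h1
    nlinarith
  · ext y
    simp

theorem ne_algebraMap_of_ker_ne_bot {X : End F V} (hX : X ≠ 0)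
    (hker : LinearMap.ker X ≠ ⊥) (c : F) : X ≠ algebraMap F (End F V) c := by
  rintro rfl
  obtain ⟨v, hv, hv0⟩ := Submodule.exists_mem_ne_zero_of_ne_bot hker
  have hc : c = 0 := by simpa [hv0] using hv
  exact hX (by simp [hc])

/-- Every `A` commutes with a nonscalar `X` that has narrow commutants. If `F[A]` has zero divisors
`a * b = 0`, then `X` is the one with the larger kernel; if `F[A]` is a field of degree less than
`dim V`, then `X` is `F[A]`-linear of rank one over `F[A]`; if `F[A]` is a field of degree
`dim V`, then `X` is taken from an intermediate field of small degree. -/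
theorem exists_commute_hasNarrowCommutants {F V : Type} [Field F] [AddCommGroup V] [Module F V]
    [FiniteDimensional F V] (hV : 3 ≤ finrank F V)
    (hsub : ∀ (K : Type) [Field K] [Algebra F K], finrank F K = finrank F V →
      ∃ E : IntermediateField F K, 1 < finrank F E ∧ finrank F E ^ 2 < finrank F V)
    (A : End F V) :
    ∃ X : End F V, (∀ c, X ≠ algebraMap F (End F V) c) ∧ Commute A X ∧
      HasNarrowCommutants X := by
  -- a nonzero operator with large kernel is never scalar
  have large : ∀ X : End F V, X ≠ 0 → Commute A X →
      finrank F V ≤ 2 * finrank F (LinearMap.ker X) →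
      ∃ X : End F V, (∀ c, X ≠ algebraMap F (End F V) c) ∧ Commute A X ∧
        HasNarrowCommutants X := fun X hX hAX hker =>
    ⟨X, ne_algebraMap_of_ker_ne_bot hX (by rintro h; rw [h, finrank_bot] at hker; omega), hAX,
      hasNarrowCommutants_of_le_two_mul_finrank_ker hV hker⟩
  let K := Algebra.adjoin F {A}
  have hcomm : ∀ a ∈ K, Commute A a := fun a ha => Algebra.commute_of_mem_adjoin_self ha
  have : Nontrivial V := finrank_pos_iff.1 (by omega : 0 < finrank F V)
  have : IsMulCommutative K := Algebra.isMulCommutative_adjoin F (by simp)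
  by_cases hdom : NoZeroDivisors K
  · have : IsDomain K := NoZeroDivisors.to_isDomain K
    let : Field K := (isField_of_isIntegral_of_isField' (R := F) (S := K) (Field.toIsField F)).toField
    by_cases hK : finrank F K = finrank F V
    · obtain ⟨E, h1, h2⟩ := hsub K hK
      have : IsScalarTower F E V := ⟨fun c x v => rfl⟩
      have : ∃ x : E, x ∉ (⊥ : Subalgebra F E) := by
        by_contra! h
        have h3 : (⊥ : Subalgebra F E) = ⊤ := top_le_iff.1 fun x _ => h x
        have h4 := Subalgebra.bot_eq_top_iff_finrank_eq_one.1 h3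
        omega
      obtain ⟨x, hx⟩ := this
      refine ⟨Algebra.lsmul F F V x, fun c hc => hx ?_, ?_, hasNarrowCommutants_lsmul h2 x⟩
      · refine Algebra.mem_bot.2 ⟨c, ?_⟩
        apply Subtype.ext
        apply Subtype.ext
        ext v
        exact (LinearMap.congr_fun hc v).symm
      · exact hcomm _ x.1.2
    · obtain ⟨X, hX, hker, hc⟩ := exists_ne_zero_commute_lsmul (F := F) (E := K) (V := V) hK (by omega)
      exact large X hX (hc ⟨A, Algebra.self_mem_adjoin_singleton F A⟩) hker
  · have : ∃ a b : K, a * b = 0 ∧ a ≠ 0 ∧ b ≠ 0 := by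
      by_contra! h
      exact hdom ⟨fun {a b} hab => or_iff_not_imp_left.2 (h a b hab)⟩
    obtain ⟨a, b, hab, ha, hb⟩ := this
    have hab' : (a : End F V) * b = 0 := congrArg Subtype.val hab
    -- `range b ≤ ker a`, so the dimensions of the two kernels add up to at least `dim V`
    have hle := Submodule.finrank_mono (LinearMap.range_le_ker_iff.2 hab')
    have hr := LinearMap.finrank_range_add_finrank_ker (b : End F V)
    rcases le_total (finrank F (LinearMap.ker (a : End F V)))
      (finrank F (LinearMap.ker (b : End F V))) with h | h
    · exact large b (by simpa using hb) (hcomm _ b.2) (by omega)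
    · exact large a (by simpa using ha) (hcomm _ a.2) (by omega)

end Narrow

/-! ### Quadratic extensions of the `p`-adic numbers -/

section Padic

theorem padic_sq_ne_prime (p : ℕ) [Fact p.Prime] (b : ℚ_[p]) : b ^ 2 ≠ p := by
  intro h
  -- the valuation of a square is even, that of `p` is `1`
  have := congrArg Padic.valuation h
  rw [Padic.valuation_pow, Padic.valuation_p] at this
  omega

theorem exists_quadratic_extension_padic (p : ℕ) [Fact p.Prime] :
    ∃ (K : Type) (_ : Field K) (_ : Algebra ℚ_[p] K), finrank ℚ_[p] K = 2 := by
  have hirr : Irreducible (Polynomial.X ^ 2 - Polynomial.C (p : ℚ_[p])) :=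
    X_pow_sub_C_irreducible_of_prime Nat.prime_two (padic_sq_ne_prime p)
  have := Fact.mk hirr
  refine ⟨AdjoinRoot (Polynomial.X ^ 2 - Polynomial.C (p : ℚ_[p])), inferInstance,
    inferInstance, ?_⟩
  rw [(AdjoinRoot.powerBasis hirr.ne_zero).finrank, AdjoinRoot.powerBasis_dim,
    Polynomial.natDegree_X_pow_sub_C]

end Padic

/-! ### Distances in the commuting graph -/

theorem edist_commutingGraph_le_one {F : Type*} [Field F] {n : ℕ}
    {A B : {A : Matrix (Fin n) (Fin n) F // ∀ c : F, A ≠ Matrix.scalar (Fin n) c}}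
    (h : Commute A.1 B.1) : (commutingGraph F n).edist A B ≤ 1 := by
  by_cases hAB : A = B
  · rw [hAB, SimpleGraph.edist_self]
    exact zero_le_one
  · exact le_of_eq (SimpleGraph.edist_eq_one_iff_adj.2 ⟨hAB, h⟩)

/-- Over every field and for `n ≥ 3`, the bound holds if each field extension of degree `n` has a
nontrivial intermediate field of degree less than `√n`. -/
theorem ediam_commutingGraph_le_five {F : Type} [Field F] {n : ℕ} (hn : 3 ≤ n)
    (hsub : ∀ (K : Type) [Field K] [Algebra F K], finrank F K = n →
      ∃ E : IntermediateField F K, 1 < finrank F E ∧ finrank F E ^ 2 < n) :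
    (commutingGraph F n).ediam ≤ 5 := by
  have hV : finrank F (Fin n → F) = n := by simp
  let e : Matrix (Fin n) (Fin n) F ≃ₐ[F] End F (Fin n → F) := Matrix.toLinAlgEquiv'
  have vertex : ∀ X : End F (Fin n → F), (∀ c, X ≠ algebraMap F _ c) →
      ∀ c : F, e.symm X ≠ Matrix.scalar (Fin n) c := fun X hX c h => hX c <| by
    rw [← e.commutes c, ← e.symm_apply_eq, h]
    rfl
  have key := exists_commute_hasNarrowCommutants (F := F) (V := Fin n → F) (by rwa [hV])
    (by rwa [hV])
  refine SimpleGraph.ediam_le_of_edist_le fun A B => ?_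
  obtain ⟨X, hX, hAX, hX'⟩ := key (e A.1)
  obtain ⟨Y, hY, hBY, hY'⟩ := key (e B.1)
  obtain ⟨U, W, hU, hW, hXU, hYW, hUW, hWU⟩ := hX'.exists_mul_eq_zero hY'
  let G := commutingGraph F n
  let x : {A : Matrix (Fin n) (Fin n) F // ∀ c : F, A ≠ Matrix.scalar (Fin n) c} :=
    ⟨e.symm X, vertex X hX⟩
  let y : {A : Matrix (Fin n) (Fin n) F // ∀ c : F, A ≠ Matrix.scalar (Fin n) c} :=
    ⟨e.symm Y, vertex Y hY⟩
  let u : {A : Matrix (Fin n) (Fin n) F // ∀ c : F, A ≠ Matrix.scalar (Fin n) c} :=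
    ⟨e.symm U, vertex U (ne_algebraMap_of_mul_eq_zero hU hW hUW)⟩
  let w : {A : Matrix (Fin n) (Fin n) F // ∀ c : F, A ≠ Matrix.scalar (Fin n) c} :=
    ⟨e.symm W, vertex W (ne_algebraMap_of_mul_eq_zero hW hU hWU)⟩
  have h1 : G.edist A x ≤ 1 :=
    edist_commutingGraph_le_one (by simpa [x] using hAX.map e.symm)
  have h2 : G.edist x u ≤ 1 := edist_commutingGraph_le_one (hXU.map e.symm)
  have h3 : G.edist u w ≤ 1 := edist_commutingGraph_le_one (Commute.map (hUW.trans hWU.symm) e.symm)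
  have h4 : G.edist w y ≤ 1 := edist_commutingGraph_le_one (hYW.symm.map e.symm)
  have h5 : G.edist y B ≤ 1 :=
    edist_commutingGraph_le_one (by simpa [y] using hBY.symm.map e.symm)
  calc G.edist A B
      ≤ G.edist A x + (G.edist x u + (G.edist u w + (G.edist w y + G.edist y B))) :=
        SimpleGraph.edist_triangle.trans <| add_le_add_right (SimpleGraph.edist_triangle.trans <|
          add_le_add_right (SimpleGraph.edist_triangle.trans <|
          add_le_add_right SimpleGraph.edist_triangle _) _) _
    _ ≤ 1 + (1 + (1 + (1 + 1))) := by gcongr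
    _ = 5 := by norm_num

theorem mainTheorem6 (p : ℕ) [Fact p.Prime] (n : ℕ) (hn : 2 ≤ n)
    (hconn : (commutingGraph ℚ_[p] n).Connected)
    (hsub : ∀ (K : Type) [Field K] [Algebra ℚ_[p] K], Module.finrank ℚ_[p] K = n →
      ∃ E : IntermediateField ℚ_[p] K,
        1 < Module.finrank ℚ_[p] E ∧ (Module.finrank ℚ_[p] E : ℝ) < Real.sqrt n) :
    (commutingGraph ℚ_[p] n).ediam ≤ 5 := by
  have hsub' : ∀ (K : Type) [Field K] [Algebra ℚ_[p] K], finrank ℚ_[p] K = n →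
      ∃ E : IntermediateField ℚ_[p] K, 1 < finrank ℚ_[p] E ∧ finrank ℚ_[p] E ^ 2 < n := by
    intro K _ _ hK
    obtain ⟨E, h1, h2⟩ := hsub K hK
    rw [Real.lt_sqrt (Nat.cast_nonneg _)] at h2
    exact ⟨E, h1, by exact_mod_cast h2⟩
  -- for `n = 2` the condition `1 < [E : ℚ_p] < √n` cannot hold, but quadratic extensions exist
  have hn2 : n ≠ 2 := by
    rintro rfl
    obtain ⟨K, _, _, hK⟩ := exists_quadratic_extension_padic p
    obtain ⟨E, h1, h2⟩ := hsub' K hK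
    nlinarith
  exact ediam_commutingGraph_le_five (by omega) hsub'
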